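/- Let $32_{65}$ denote the finite relation algebra with four atoms $1'$ (identity), $a$ (red), $b$ (light blue) and $c$ (dark blue), all of them symmetric (each is its own converse), in which, for diversity atoms $x,y,z\in\{a,b,c\}$, one has $z\le x\mathbin{;}y$ if $a\in\{x,y,z\}$ and $z\cdot(x\mathbin{;}y)=0$ otherwise. A representation of $32_{65}$ over a set $U$ is an embedding $\rho$ of $32_{65}$ into the algebra $\langle \mathrm{Powerset}(E),\cup,{}^c,\circ,{}^{-1},\mathrm{Id}_U\rangle$ for some equivalence relation $E$ on $U$ (for instance $E=U\times U$), where ${}^c$ is complementation relative to $E$. The red subgraph of $\rho$ is the graph on $U$ in which $x$ and $y$ are adjacent if and only if $(x,y)\in\rho(a)$. In any representation of $32_{65}$, over a finite or an infinite set, the clique number of the red subgraph is at least six; that is, the red subgraph contains a $K_6$. -/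

import Mathlib

open scoped SetRel

/-- Relation algebras: a Boolean algebra with an involuted monoid `(;, conv, 1')` such that
composition and converse are additive and the cycle law holds. -/
class RelationAlgebra (A : Type*) extends BooleanAlgebra A where
  /-- relative multiplication `x ; y` -/
  comp : A → A → A
  /-- converse -/
  conv : A → A
  /-- the identity element `1'` -/
  ident : A
  comp_assoc : ∀ x y z : A, comp (comp x y) z = comp x (comp y z)
  ident_comp : ∀ x : A, comp ident x = x
  comp_ident : ∀ x : A, comp x ident = x
  conv_conv : ∀ x : A, conv (conv x) = x
  conv_comp : ∀ x y : A, conv (comp x y) = comp (conv y) (conv x)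
  comp_sup : ∀ x y z : A, comp x (y ⊔ z) = comp x y ⊔ comp x z
  conv_sup : ∀ x y : A, conv (x ⊔ y) = conv x ⊔ conv y
  cycle_law : ∀ x y z : A, comp x y ⊓ conv z = ⊥ ↔ comp y z ⊓ conv x = ⊥

/-- A representation of the relation algebra `A` over the set `U`: an equivalence relation `E`
on `U` and an embedding of `A` into the algebra of all subrelations of `E`, with union,
complement relative to `E`, relational composition, converse and the identity relation.
The representations with `E = ⊤` are those in the algebra of all subsets of `U × U`. -/
structure RARepresentation (A : Type*) [RelationAlgebra A] (U : Type*) where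
  /-- the unit of the representation -/
  E : Setoid U
  /-- the embedding -/
  map : A → SetRel U U
  map_subset : ∀ x : A, map x ⊆ {p | E p.1 p.2}
  injective : Function.Injective map
  map_sup : ∀ x y : A, map (x ⊔ y) = map x ∪ map y
  map_compl : ∀ x : A, map xᶜ = {p | E p.1 p.2} \ map x
  map_comp : ∀ x y : A, map (RelationAlgebra.comp x y) = map x ○ map y
  map_conv : ∀ x : A, map (RelationAlgebra.conv x) = (map x).inv
  map_ident : map RelationAlgebra.ident = SetRel.id

/-- The atoms of `32_65`: the identity atom `1'` and the diversity atoms `a` (red),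
`b` (light blue), `c` (dark blue). -/
inductive Atom3265 : Type
  | one
  | red
  | lightBlue
  | darkBlue

namespace Atom3265

/-- `Cycle x y z` means that the atom `z` lies below `x ; y`. Cycles with an identity atom are
determined by `1'` being a two-sided unit and by all atoms being symmetric; a cycle of diversity
atoms is mandatory exactly when it involves red. -/
def Cycle : Atom3265 → Atom3265 → Atom3265 → Prop
  | one, y, z => y = z
  | x, one, z => x = z
  | x, y, one => x = y
  | x, y, z => x = red ∨ y = red ∨ z = red

theorem Cycle.swap {x y z : Atom3265} (h : Cycle x y z) : Cycle y x z := by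
  cases x <;> cases y <;> cases z <;> simp_all [Cycle]

theorem Cycle.rotate {x y z : Atom3265} (h : Cycle x y z) : Cycle y z x := by
  cases x <;> cases y <;> cases z <;> simp_all [Cycle]

theorem cycle_one_left {x y : Atom3265} : Cycle one x y ↔ x = y := Iff.rfl

theorem Cycle.assoc {x y z w : Atom3265} :
    (∃ u, Cycle x y u ∧ Cycle u z w) → ∃ v, Cycle y z v ∧ Cycle x v w := by
  rintro ⟨u, h₁, h₂⟩
  have key : Cycle y z one ∧ Cycle x one w ∨ Cycle y z red ∧ Cycle x red w ∨
      Cycle y z lightBlue ∧ Cycle x lightBlue w ∨ Cycle y z darkBlue ∧ Cycle x darkBlue w := by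
    cases x <;> cases y <;> cases z <;> cases w <;> cases u <;> simp_all [Cycle]
  rcases key with h | h | h | h
  exacts [⟨_, h⟩, ⟨_, h⟩, ⟨_, h⟩, ⟨_, h⟩]

end Atom3265

/-- The relation algebra `32_65`: its elements are the sets of atoms, each standing for the join
of its members; every element is its own converse. -/
def RA3265 : Type := Set Atom3265

namespace RA3265

instance : BooleanAlgebra RA3265 := inferInstanceAs (BooleanAlgebra (Set Atom3265))

/-- The composition of `32_65`: the additive extension of the cycle structure on atoms. -/
def comp (X Y : Set Atom3265) : Set Atom3265 :=
  {z | ∃ x ∈ X, ∃ y ∈ Y, Atom3265.Cycle x y z}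

theorem comp_comm (X Y : Set Atom3265) : comp X Y = comp Y X := by
  ext z
  constructor <;> rintro ⟨x, hx, y, hy, h⟩ <;> exact ⟨y, hy, x, hx, h.swap⟩

theorem comp_assoc_le (X Y Z : Set Atom3265) : comp (comp X Y) Z ⊆ comp X (comp Y Z) := by
  rintro w ⟨u, ⟨x, hx, y, hy, h₁⟩, z, hz, h₂⟩
  obtain ⟨v, h₃, h₄⟩ := Atom3265.Cycle.assoc ⟨u, h₁, h₂⟩
  exact ⟨x, hx, v, ⟨y, hy, z, hz, h₃⟩, h₄⟩

theorem comp_assoc (X Y Z : Set Atom3265) : comp (comp X Y) Z = comp X (comp Y Z) := by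
  refine (comp_assoc_le X Y Z).antisymm ?_
  rw [comp_comm X (comp Y Z), comp_comm Y Z, comp_comm (comp X Y) Z, comp_comm X Y]
  exact comp_assoc_le Z Y X

theorem one_comp (X : Set Atom3265) : comp {Atom3265.one} X = X := by
  ext z
  simp [comp, Atom3265.cycle_one_left]

theorem comp_union (X Y Z : Set Atom3265) : comp X (Y ∪ Z) = comp X Y ∪ comp X Z := by
  ext w
  constructor
  · rintro ⟨x, hx, y, hy | hy, h⟩
    exacts [Or.inl ⟨x, hx, y, hy, h⟩, Or.inr ⟨x, hx, y, hy, h⟩]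
  · rintro (⟨x, hx, y, hy, h⟩ | ⟨x, hx, y, hy, h⟩)
    exacts [⟨x, hx, y, Or.inl hy, h⟩, ⟨x, hx, y, Or.inr hy, h⟩]

theorem comp_inter_eq_empty (X Y Z : Set Atom3265) :
    comp X Y ∩ Z = ∅ ↔ ∀ x ∈ X, ∀ y ∈ Y, ∀ z ∈ Z, ¬ Atom3265.Cycle x y z := by
  rw [Set.eq_empty_iff_forall_notMem]
  constructor
  · exact fun h x hx y hy z hz hc => h z ⟨⟨x, hx, y, hy, hc⟩, hz⟩
  · rintro h z ⟨⟨x, hx, y, hy, hc⟩, hz⟩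
    exact h x hx y hy z hz hc

theorem cycle_law (X Y Z : Set Atom3265) : comp X Y ∩ Z = ∅ ↔ comp Y Z ∩ X = ∅ := by
  rw [comp_inter_eq_empty, comp_inter_eq_empty]
  exact ⟨fun h y hy z hz x hx hc => h x hx y hy z hz hc.rotate.rotate,
    fun h x hx y hy z hz hc => h y hy z hz x hx hc.rotate⟩

instance : RelationAlgebra RA3265 where
  comp := comp
  conv := fun X => X
  ident := ({Atom3265.one} : Set Atom3265)
  comp_assoc := comp_assoc
  ident_comp := one_comp
  comp_ident := fun X => (comp_comm X _).trans (one_comp X)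
  conv_conv := fun _ => rfl
  conv_comp := comp_comm
  comp_sup := comp_union
  conv_sup := fun _ _ => rfl
  cycle_law := cycle_law

/-- An atom, as an element of the algebra. -/
def ofAtom (t : Atom3265) : RA3265 := ({t} : Set Atom3265)

end RA3265

/-- The red subgraph of a representation of `32_65`: the points `x` and `y` are joined exactly
when the pair `(x, y)` lies in the relation that represents the atom red. -/
def RARepresentation.redGraph {U : Type*} (ρ : RARepresentation RA3265 U) : SimpleGraph U where
  Adj x y := (x, y) ∈ ρ.map (RA3265.ofAtom Atom3265.red)
  symm := ⟨fun x y h => by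
    have h₁ := ρ.map_conv (RA3265.ofAtom Atom3265.red)
    change ρ.map (RA3265.ofAtom Atom3265.red) = _ at h₁
    rw [h₁]
    exact h⟩
  loopless := ⟨fun x h => by
    have h₁ : (RelationAlgebra.ident : RA3265) ⊔ (RA3265.ofAtom Atom3265.red)ᶜ =
        (RA3265.ofAtom Atom3265.red)ᶜ := by
      refine sup_eq_right.mpr ?_
      change ({Atom3265.one} : Set Atom3265) ⊆ ({Atom3265.red} : Set Atom3265)ᶜ
      simp
    have h₂ := ρ.map_sup RelationAlgebra.ident (RA3265.ofAtom Atom3265.red)ᶜ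
    rw [h₁, ρ.map_compl, ρ.map_ident] at h₂
    have h₃ : (x, x) ∈ ({p | ρ.E p.1 p.2} : Set (U × U)) \
        ρ.map (RA3265.ofAtom Atom3265.red) := by
      rw [h₂]
      exact Or.inl rfl
    exact h₃.2 h⟩

namespace RARepresentation

variable {U : Type*}

/-! Fix a point `v`. Since no triangle is entirely blue, any two distinct points joined to `v` by
blue edges, of either shade, are joined to each other in red: the blue neighbourhood of `v` is a red
clique (`HasColour.red_of_blue`). It has at least six points, because `v` has three neighbours in
each shade (`exists_three_hasColour`) and an edge has only one colour. Finiteness of `U` plays no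
role. -/

theorem map_mono {A : Type*} [RelationAlgebra A] (ρ : RARepresentation A U) {x y : A}
    (h : x ≤ y) : ρ.map x ⊆ ρ.map y := by
  rw [← sup_eq_right.mpr h, ρ.map_sup]
  exact Set.subset_union_left

/-- An empty set carries only one relation, so a nontrivial algebra cannot embed over it. -/
theorem nonempty {A : Type*} [RelationAlgebra A] [Nontrivial A] (ρ : RARepresentation A U) :
    Nonempty U := by
  by_contra h
  rw [not_nonempty_iff] at h
  obtain ⟨x, y, hxy⟩ := exists_pair_ne A
  exact hxy (ρ.injective (Set.ext fun p => h.elim p.1))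

variable (ρ : RARepresentation RA3265 U)

/-- The edge between `x` and `y` has the colour `t`. -/
def HasColour (t : Atom3265) (x y : U) : Prop := (x, y) ∈ ρ.map (RA3265.ofAtom t)

variable {ρ}

theorem hasColour_one {x y : U} : ρ.HasColour .one x y ↔ x = y := by
  have h : ρ.map (RA3265.ofAtom .one) = SetRel.id := ρ.map_ident
  rw [HasColour, h]
  rfl

theorem HasColour.symm {t : Atom3265} {x y : U} (h : ρ.HasColour t x y) :
    ρ.HasColour t y x := by
  have h₁ : ρ.map (RA3265.ofAtom t) = (ρ.map (RA3265.ofAtom t)).inv :=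
    ρ.map_conv (RA3265.ofAtom t)
  rw [HasColour, h₁] at h
  exact h

theorem HasColour.unique {s t : Atom3265} {x y : U} (hs : ρ.HasColour s x y)
    (ht : ρ.HasColour t x y) : s = t := by
  by_contra hst
  have hle : RA3265.ofAtom s ≤ (RA3265.ofAtom t)ᶜ := by
    change ({s} : Set Atom3265) ⊆ ({t} : Set Atom3265)ᶜ
    simpa [eq_comm] using hst
  have h := ρ.map_mono hle hs
  rw [ρ.map_compl] at h
  exact h.2 ht

/-- The device for separating witnesses: points seen from `z` in different colours are different. -/
theorem HasColour.ne {s t : Atom3265} {x y z : U} (hs : ρ.HasColour s x z)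
    (ht : ρ.HasColour t y z) (hst : s ≠ t) : x ≠ y := by
  rintro rfl
  exact hst (hs.unique ht)

/-- The source of all new points: `u ≤ s ; t` holds in the algebra, and `;` is represented by true
relational composition. -/
theorem HasColour.exists_of_cycle {s t u : Atom3265} {x y : U} (h : ρ.HasColour u x y)
    (hc : Atom3265.Cycle s t u) : ∃ w, ρ.HasColour s x w ∧ ρ.HasColour t w y := by
  have hle : RA3265.ofAtom u ≤
      RelationAlgebra.comp (RA3265.ofAtom s) (RA3265.ofAtom t) := by
    change ({u} : Set Atom3265) ⊆ RA3265.comp {s} {t}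
    simpa [RA3265.comp] using hc
  have h₁ := ρ.map_mono hle h
  rwa [ρ.map_comp] at h₁

/-- There is no triangle without a red edge. -/
theorem HasColour.red_of_blue {s t : Atom3265} {x y z : U} (hs : ρ.HasColour s z x)
    (ht : ρ.HasColour t z y) (hxy : x ≠ y) (hs' : s = .lightBlue ∨ s = .darkBlue)
    (ht' : t = .lightBlue ∨ t = .darkBlue) : ρ.redGraph.Adj x y := by
  -- With `s` and `t` blue, the only atoms that can lie below `s ; t` are `1'` and red; `x ≠ y` then
  -- excludes `1'`.
  have hle : RelationAlgebra.comp (RA3265.ofAtom s) (RA3265.ofAtom t) ≤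
      RA3265.ofAtom .one ⊔ RA3265.ofAtom .red := by
    change RA3265.comp {s} {t} ⊆ ({.one} ∪ {.red} : Set Atom3265)
    rintro u ⟨_, rfl, _, rfl, h⟩
    rcases hs' with rfl | rfl <;> rcases ht' with rfl | rfl <;> cases u <;>
      simp_all [Atom3265.Cycle]
  have h : (x, y) ∈ ρ.map (RelationAlgebra.comp (RA3265.ofAtom s) (RA3265.ofAtom t)) := by
    rw [ρ.map_comp]
    exact ⟨z, hs.symm, ht⟩
  have h₁ := ρ.map_mono hle h
  rw [ρ.map_sup] at h₁
  exact h₁.resolve_left fun h₂ => hxy (hasColour_one.mp h₂)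

/-- Every point has three neighbours of each blue colour `t`: a neighbour `p`, and two further
ones on paths to a point that is joined in red to both ends of the edge to `p`. -/
theorem exists_three_hasColour (v : U) {t : Atom3265} (ht : t = .lightBlue ∨ t = .darkBlue) :
    ∃ s : Finset U, s.card = 3 ∧ ∀ x ∈ s, ρ.HasColour t v x := by
  classical
  -- The loop at `v` has colour `1'`, and `1' ≤ t ; t`.
  obtain ⟨p, hvp, -⟩ := (hasColour_one.mpr (rfl : v = v) : ρ.HasColour _ v v).exists_of_cycle
    (s := t) (t := t) (by rcases ht with rfl | rfl <;> rfl)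
  obtain ⟨w, hvw, hwp⟩ := hvp.exists_of_cycle (s := .red) (t := .red)
    (by rcases ht with rfl | rfl <;> simp [Atom3265.Cycle])
  -- As the edge from `v` to `w` is red, both shades are available for the second leg of the path.
  obtain ⟨q, hvq, hqw⟩ := hvw.exists_of_cycle (s := t) (t := .lightBlue)
    (by rcases ht with rfl | rfl <;> simp [Atom3265.Cycle])
  obtain ⟨r, hvr, hrw⟩ := hvw.exists_of_cycle (s := t) (t := .darkBlue)
    (by rcases ht with rfl | rfl <;> simp [Atom3265.Cycle])
  -- From `w`, the points `p`, `q`, `r` are seen in red, light blue and dark blue respectively.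
  refine ⟨{p, q, r}, Finset.card_eq_three.mpr ⟨p, q, r, hwp.symm.ne hqw (by simp),
    hwp.symm.ne hrw (by simp), hqw.ne hrw (by simp), rfl⟩, ?_⟩
  simp only [Finset.mem_insert, Finset.mem_singleton]
  rintro x (rfl | rfl | rfl) <;> assumption

theorem exists_isNClique_six (ρ : RARepresentation RA3265 U) :
    ∃ s : Finset U, ρ.redGraph.IsNClique 6 s := by
  classical
  have : Nonempty Atom3265 := ⟨.one⟩
  have : Nontrivial RA3265 := inferInstanceAs (Nontrivial (Set Atom3265))
  obtain ⟨v⟩ := ρ.nonempty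
  obtain ⟨s, hs, hsv⟩ := exists_three_hasColour (ρ := ρ) v (Or.inl rfl)
  obtain ⟨t, ht, htv⟩ := exists_three_hasColour (ρ := ρ) v (Or.inr rfl)
  have hd : Disjoint s t := Finset.disjoint_left.mpr fun x hx hx' =>
    Atom3265.noConfusion ((hsv x hx).unique (htv x hx'))
  have hblue : ∀ x ∈ s ∪ t, ∃ u, (u = .lightBlue ∨ u = .darkBlue) ∧ ρ.HasColour u v x := by
    intro x hx
    rcases Finset.mem_union.mp hx with hx | hx
    exacts [⟨_, Or.inl rfl, hsv x hx⟩, ⟨_, Or.inr rfl, htv x hx⟩]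
  refine ⟨s ∪ t, fun x hx y hy hxy => ?_, by rw [Finset.card_union_of_disjoint hd, hs, ht]⟩
  obtain ⟨i, hi, hvx⟩ := hblue x hx
  obtain ⟨j, hj, hvy⟩ := hblue y hy
  exact hvx.red_of_blue hvy hxy hi hj

end RARepresentation

/-- `cliqueNum` is a supremum in the naturals, with value 0 when clique sizes are unbounded; hence
the explicit clique for arbitrary `U` and the numerical bound for finite `U`. -/
theorem mainTheorem11 {U : Type*} (ρ : RARepresentation RA3265 U) :
    (∃ s : Finset U, ρ.redGraph.IsNClique 6 s) ∧
      (Finite U → 6 ≤ ρ.redGraph.cliqueNum) := by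
  obtain ⟨s, hs⟩ := ρ.exists_isNClique_six
  refine ⟨⟨s, hs⟩, fun _ => ?_⟩
  rw [← hs.card_eq]
  exact hs.isClique.card_le_cliqueNum
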